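/- Let $S$ be a Polish space with its Borel $\sigma$-algebra, let $\pi$ be a probability measure on $S$, and let $(P_t)_{t\ge 0}$ be a semigroup of Markov kernels on $S$ ($P_0=\mathrm{id}$, $P_{s+t}=P_sP_t$) that is reversible with respect to $\pi$, i.e. $\pi(dx)P_t(x,dy)=\pi(dy)P_t(y,dx)$ for all $t\ge 0$, that is strongly continuous on $L^2(\pi)$, and that is ergodic: every measurable set $A$ with $P_t1_A=1_A$ $\pi$-a.e. for all $t\ge0$ has $\pi(A)\in\{0,1\}$. Let $X=(X_t)_{t\ge 0}$ be a (jointly measurable) Markov process with transition semigroup $(P_t)$ and initial distribution $\pi$, and write $\mathbb E_\pi$ for the expectation. No exponential ergodicity is assumed. Let $(u,v)=\int_S uv\,d\pi$ be the inner product of the real space $L^2(\pi)$, and let $L$ be the infinitesimal generator of $(P_t)$ in $L^2(\pi)$, with domain $\mathscr D(L)$. Let $\mathscr F\subset L^2(\pi)$ be the completion of $\mathscr D(L)$ with respect to the norm $\big((-Lu,u)+(u,u)\big)^{1/2}$, and let $\mathscr E$ be the extension to $\mathscr F$, by continuity, of the form $\mathscr E(u,v)=(-Lu,v)$, $u,v\in\mathscr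 D(L)$. For $f\in L^2(\pi)$ with $\int_S f\,d\pi=0$ put $$\sigma^2(X,f)=\limsup_{t\to\infty}\mathbb E_\pi\Big[\Big(\frac1{\sqrt t}\int_0^t f(X_s)\,ds\Big)^2\Big]\in[0,\infty].$$ Then for every such $f$, $$\frac{2}{\sigma^2(X,f)}=\inf\{\mathscr E(u,u):\ u\in\mathscr F,\ (u,f)=1\},$$ with the conventions $2/\infty=0$, $2/0=\infty$ and $\inf\emptyset=\infty$. The value $\sigma^2(X,f)=\infty$ is allowed. -/

import Mathlib

open MeasureTheory ProbabilityTheory Filter Topology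
open scoped NNReal ENNReal

noncomputable section

namespace MarkovAV

variable {S Ω : Type*} [MeasurableSpace S] [MeasurableSpace Ω]

/-- A (conservative) transition semigroup on `S`: the Markov kernels `P_t(x, dy)`, `t ≥ 0`, satisfy
`P_0 = id` and the Chapman-Kolmogorov equations. -/
structure IsTransitionSemigroup (P : ℝ≥0 → Kernel S S) : Prop where
  markov : ∀ t, IsMarkovKernel (P t)
  zero : P 0 = Kernel.id
  add : ∀ s t, P (s + t) = P t ∘ₖ P s

/-- Reversibility: `π(dx) P_t(x, dy) = π(dy) P_t(y, dx)` for every `t ≥ 0`. -/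
def IsReversibleSemigroup (P : ℝ≥0 → Kernel S S) (π : Measure S) : Prop :=
  ∀ t, (P t).IsReversible π

/-- Ergodicity of the stationary distribution: a measurable set which is invariant under the whole
semigroup (`P_t 1_A = 1_A` almost everywhere, for all `t`) has probability `0` or `1`. -/
def IsErgodicSemigroup (P : ℝ≥0 → Kernel S S) (π : Measure S) : Prop :=
  ∀ A : Set S, MeasurableSet A →
    (∀ t, ∀ᵐ x ∂π, P t x A = A.indicator (fun _ => (1 : ℝ≥0∞)) x) → π A = 0 ∨ π A = 1

/-- The information available up to time `s`: the σ-algebra generated by `X_r`, `r ≤ s`. -/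
abbrev past (X : ℝ≥0 → Ω → S) (s : ℝ≥0) : MeasurableSpace Ω :=
  ⨆ r : Set.Iic s, MeasurableSpace.comap (X r) inferInstance

/-- Under the probability measure `μ`, `X` is a (jointly measurable) Markov process with
transition semigroup `P` and initial distribution `π`. Expectation under such an `μ`
is the expectation `E_π`. -/
structure IsMarkovProcess (P : ℝ≥0 → Kernel S S) (π : Measure S) (μ : Measure Ω)
    (X : ℝ≥0 → Ω → S) : Prop where
  measurable : Measurable (fun p : ℝ≥0 × Ω => X p.1 p.2)
  initial : Measure.map (X 0) μ = π
  markov : ∀ s t : ℝ≥0, ∀ A : Set S, MeasurableSet A →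
    μ[fun ω => A.indicator (fun _ => (1 : ℝ)) (X (s + t) ω) | past X s]
      =ᵐ[μ] fun ω => (P t (X s ω)).real A

/-- The asymptotic variance
`σ²(X, f) = limsup_{t → ∞} E_π[(t^{-1/2} ∫_0^t f(X_s) ds)²]`, with values in `[0, ∞]`. -/
def asymptoticVariance (μ : Measure Ω) (X : ℝ≥0 → Ω → S) (f : S → ℝ) : ℝ≥0∞ :=
  limsup (fun t : ℝ =>
    ∫⁻ ω, ENNReal.ofReal ((1 / √t * ∫ s in (0 : ℝ)..t, f (X s.toNNReal ω)) ^ 2) ∂μ) atTop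

/-- If `π` is stationary, then `u ↦ ∫ u(y) κ(x, dy)` is a contraction for the `L²(π)` norm. -/
theorem eLpNorm_integral_kernel_le {κ : Kernel S S} [IsMarkovKernel κ] {π : Measure S}
    [IsProbabilityMeasure π] (h : κ.Invariant π) (u : Lp ℝ 2 π) :
    eLpNorm (fun x => ∫ y, u y ∂(κ x)) 2 π ≤ eLpNorm (u : S → ℝ) 2 π := by
  have hsm : StronglyMeasurable (u : S → ℝ) := Lp.stronglyMeasurable u
  rw [eLpNorm_eq_lintegral_rpow_enorm_toReal (by norm_num) (by norm_num),
    eLpNorm_eq_lintegral_rpow_enorm_toReal (by norm_num) (by norm_num)]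
  refine ENNReal.rpow_le_rpow ?_ (by positivity)
  have hbind : ∫⁻ x, ‖u x‖ₑ ^ (2 : ℝ≥0∞).toReal ∂π
      = ∫⁻ x, ∫⁻ y, ‖u y‖ₑ ^ (2 : ℝ≥0∞).toReal ∂(κ x) ∂π := by
    have := Measure.lintegral_bind (m := π) (μ := κ)
      (f := fun x => ‖u x‖ₑ ^ (2 : ℝ≥0∞).toReal) κ.measurable.aemeasurable
      (hsm.enorm.pow_const _).aemeasurable
    rwa [h.def] at this
  rw [hbind]
  refine lintegral_mono fun x => ?_
  have h1 : ‖∫ y, u y ∂(κ x)‖ₑ ≤ eLpNorm (u : S → ℝ) 1 (κ x) := by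
    rw [eLpNorm_one_eq_lintegral_enorm]; exact enorm_integral_le_lintegral_enorm _
  have h2 : eLpNorm (u : S → ℝ) 1 (κ x) ≤ eLpNorm (u : S → ℝ) 2 (κ x) :=
    eLpNorm_le_eLpNorm_of_exponent_le (by norm_num) hsm.aestronglyMeasurable
  have h3 := h1.trans h2
  rw [eLpNorm_eq_lintegral_rpow_enorm_toReal (by norm_num) (by norm_num)] at h3
  calc ‖∫ y, u y ∂(κ x)‖ₑ ^ (2 : ℝ≥0∞).toReal
      ≤ ((∫⁻ y, ‖u y‖ₑ ^ (2 : ℝ≥0∞).toReal ∂(κ x)) ^ (1 / (2 : ℝ≥0∞).toReal))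
          ^ (2 : ℝ≥0∞).toReal := by gcongr
    _ = _ := by rw [← ENNReal.rpow_mul]; norm_num

/-- If `π` is stationary, then `x ↦ ∫ u(y) κ(x, dy)` is square integrable for every
square integrable `u`. -/
theorem memLp_integral_kernel {κ : Kernel S S} [IsMarkovKernel κ] {π : Measure S}
    [IsProbabilityMeasure π] (h : κ.Invariant π) (u : Lp ℝ 2 π) :
    MemLp (fun x => ∫ y, u y ∂(κ x)) 2 π :=
  ⟨((Lp.stronglyMeasurable u).integral_kernel (κ := κ)).aestronglyMeasurable,
    (eLpNorm_integral_kernel_le h u).trans_lt (Lp.memLp u).2⟩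

open Classical in
/-- The transition semigroup as operators on `L²(π)`. The case distinction
is only formal, by `memLp_integral_kernel`. -/
def semigroupL2 (P : ℝ≥0 → Kernel S S) (π : Measure S) (t : ℝ≥0) (u : Lp ℝ 2 π) : Lp ℝ 2 π :=
  if h : MemLp (fun x => ∫ y, u y ∂(P t x)) 2 π then h.toLp _ else 0

/-- Strong continuity of the semigroup in `L²(π)`. -/
def IsStronglyContinuous (P : ℝ≥0 → Kernel S S) (π : Measure S) : Prop :=
  ∀ u : Lp ℝ 2 π, Tendsto (fun t : ℝ≥0 => semigroupL2 P π t u) (𝓝[>] 0) (𝓝 u)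

/-- The difference quotient `(P_t u - u) / t`. -/
def diffQuot (P : ℝ≥0 → Kernel S S) (π : Measure S) (u : Lp ℝ 2 π) (t : ℝ≥0) : Lp ℝ 2 π :=
  (t : ℝ)⁻¹ • (semigroupL2 P π t u - u)

/-- The domain `D(L)` of the infinitesimal generator in `L²(π)`. -/
def generatorDomain (P : ℝ≥0 → Kernel S S) (π : Measure S) : Set (Lp ℝ 2 π) :=
  {u | ∃ g, Tendsto (diffQuot P π u) (𝓝[>] 0) (𝓝 g)}

/-- The infinitesimal generator `L u = lim_{t → 0+} (P_t u - u) / t`, for `u ∈ D(L)`. -/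
def generator (P : ℝ≥0 → Kernel S S) (π : Measure S) (u : Lp ℝ 2 π) : Lp ℝ 2 π :=
  haveI : Nonempty (Lp ℝ 2 π) := ⟨0⟩
  limUnder (𝓝[>] 0) (diffQuot P π u)

/-- The bilinear form `(-L u, v)` on `D(L)`. -/
def preForm (P : ℝ≥0 → Kernel S S) (π : Measure S) (u v : Lp ℝ 2 π) : ℝ :=
  inner ℝ (-generator P π u) v

/-- `w` is a sequence in `D(L)` that is Cauchy for the energy and
converges to `u` in `L²(π)`. -/
structure IsFormApprox (P : ℝ≥0 → Kernel S S) (π : Measure S) (u : Lp ℝ 2 π)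
    (w : ℕ → Lp ℝ 2 π) : Prop where
  mem : ∀ n, w n ∈ generatorDomain P π
  tendsto : Tendsto w atTop (𝓝 u)
  cauchy : Tendsto (fun p : ℕ × ℕ => preForm P π (w p.1 - w p.2) (w p.1 - w p.2)) atTop (𝓝 0)

/-- The domain `F` of the Dirichlet form: the completion, inside `L²(π)`, of `D(L)` for the norm
`((-L u, u) + (u, u))^{1/2}`. -/
def formDomain (P : ℝ≥0 → Kernel S S) (π : Measure S) : Set (Lp ℝ 2 π) :=
  {u | ∃ w, IsFormApprox P π u w}

open Classical in
/-- The Dirichlet form on `F`: the extension of `(-L u, v)` by continuity, that is, its limit along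
approximating sequences of `u` and `v`. For a reversible semigroup the limit exists and does not
depend on the sequences, see `IsFormApprox.tendsto_dirichletForm`. -/
def dirichletForm (P : ℝ≥0 → Kernel S S) (π : Measure S) (u v : Lp ℝ 2 π) : ℝ :=
  if h : u ∈ formDomain P π ∧ v ∈ formDomain P π then
    limUnder atTop (fun n => preForm P π (h.1.choose n) (h.2.choose n))
  else 0

/-- The set `{u ∈ F : (u, f) = δ}`. -/
def constraintSet (P : ℝ≥0 → Kernel S S) (π : Measure S) (f : Lp ℝ 2 π) (δ : ℝ) :
    Set (Lp ℝ 2 π) :=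
  {u | u ∈ formDomain P π ∧ inner ℝ u f = δ}

/-! The remaining facts show that `dirichletForm` is well defined for a reversible semigroup: any
approximating sequences may be used to compute it (`IsFormApprox.tendsto_dirichletForm`). -/

theorem semigroupL2_coe {P : ℝ≥0 → Kernel S S} {π : Measure S} [IsProbabilityMeasure π]
    (hP : IsTransitionSemigroup P) (hrev : IsReversibleSemigroup P π) (t : ℝ≥0) (u : Lp ℝ 2 π) :
    semigroupL2 P π t u =ᵐ[π] fun x => ∫ y, u y ∂(P t x) := by
  have := hP.markov t
  have h := memLp_integral_kernel (hrev t).invariant u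
  rw [semigroupL2, dif_pos h]
  exact h.coeFn_toLp

theorem ae_ae_of_invariant {κ : Kernel S S} [IsMarkovKernel κ] {π : Measure S}
    (h : κ.Invariant π) {p : S → Prop} (hp : ∀ᵐ x ∂π, p x) :
    ∀ᵐ x ∂π, ∀ᵐ y ∂(κ x), p y := by
  rw [← h.def] at hp
  exact Measure.ae_ae_of_ae_comp hp

theorem ae_integrable {κ : Kernel S S} [IsMarkovKernel κ] {π : Measure S}
    [IsProbabilityMeasure π] (h : κ.Invariant π) (u : Lp ℝ 2 π) :
    ∀ᵐ x ∂π, Integrable (u : S → ℝ) (κ x) := by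
  have hl : ∫⁻ x, ∫⁻ y, ‖u y‖ₑ ∂(κ x) ∂π ≠ ∞ := by
    have hsm : StronglyMeasurable (u : S → ℝ) := Lp.stronglyMeasurable u
    have h1 := Measure.lintegral_bind (m := π) (μ := κ)
      (f := fun x => ‖u x‖ₑ) κ.measurable.aemeasurable hsm.enorm.aemeasurable
    rw [h.def] at h1
    rw [← h1]
    exact ((Lp.memLp u).integrable (by norm_num)).2.ne
  filter_upwards [ae_lt_top
    ((Lp.stronglyMeasurable u).enorm.lintegral_kernel (κ := κ)) hl] with x hx
  exact ⟨(Lp.stronglyMeasurable u).aestronglyMeasurable, hx⟩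

theorem semigroupL2_sub {P : ℝ≥0 → Kernel S S} {π : Measure S} [IsProbabilityMeasure π]
    (hP : IsTransitionSemigroup P) (hrev : IsReversibleSemigroup P π) (t : ℝ≥0)
    (u v : Lp ℝ 2 π) :
    semigroupL2 P π t (u - v) = semigroupL2 P π t u - semigroupL2 P π t v := by
  have := hP.markov t
  have hi := (hrev t).invariant
  apply Lp.ext
  filter_upwards [semigroupL2_coe hP hrev t (u - v), semigroupL2_coe hP hrev t u,
    semigroupL2_coe hP hrev t v, Lp.coeFn_sub (semigroupL2 P π t u) (semigroupL2 P π t v),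
    ae_ae_of_invariant hi (Lp.coeFn_sub u v), ae_integrable hi u, ae_integrable hi v]
    with x h1 h2 h3 h4 h5 h6 h7
  rw [h1, h4, Pi.sub_apply, h2, h3, ← integral_sub h6 h7]
  exact integral_congr_ae h5

theorem semigroupL2_smul {P : ℝ≥0 → Kernel S S} {π : Measure S} [IsProbabilityMeasure π]
    (hP : IsTransitionSemigroup P) (hrev : IsReversibleSemigroup P π) (t : ℝ≥0)
    (c : ℝ) (u : Lp ℝ 2 π) :
    semigroupL2 P π t (c • u) = c • semigroupL2 P π t u := by
  have := hP.markov t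
  have hi := (hrev t).invariant
  apply Lp.ext
  filter_upwards [semigroupL2_coe hP hrev t (c • u), semigroupL2_coe hP hrev t u,
    Lp.coeFn_smul c (semigroupL2 P π t u), ae_ae_of_invariant hi (Lp.coeFn_smul c u)]
    with x h1 h2 h3 h4
  rw [h1, h3, Pi.smul_apply, h2, ← integral_smul]
  exact integral_congr_ae h4

theorem norm_semigroupL2_le {P : ℝ≥0 → Kernel S S} {π : Measure S} [IsProbabilityMeasure π]
    (hP : IsTransitionSemigroup P) (hrev : IsReversibleSemigroup P π) (t : ℝ≥0) (u : Lp ℝ 2 π) :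
    ‖semigroupL2 P π t u‖ ≤ ‖u‖ := by
  have := hP.markov t
  rw [Lp.norm_def, Lp.norm_def]
  refine ENNReal.toReal_mono (Lp.memLp u).2.ne ?_
  rw [eLpNorm_congr_ae (semigroupL2_coe hP hrev t u)]
  exact eLpNorm_integral_kernel_le (hrev t).invariant u

theorem inner_semigroupL2 {P : ℝ≥0 → Kernel S S} {π : Measure S} [IsProbabilityMeasure π]
    (hP : IsTransitionSemigroup P) (hrev : IsReversibleSemigroup P π) (t : ℝ≥0)
    (u v : Lp ℝ 2 π) :
    inner ℝ (semigroupL2 P π t u) v = inner ℝ u (semigroupL2 P π t v) := by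
  have := hP.markov t
  have hinv := (hrev t).invariant
  set κ := P t with hκ
  have hswap : (π ⊗ₘ κ).map Prod.swap = π ⊗ₘ κ := by
    refine Measure.ext_prod fun {A B} hA hB => ?_
    rw [Measure.map_apply measurable_swap (hA.prod hB), Set.preimage_swap_prod,
      Measure.compProd_apply_prod hB hA, Measure.compProd_apply_prod hA hB]
    exact hrev t hB hA
  have hsnd : (π ⊗ₘ κ).map Prod.snd = π := by
    have := Measure.snd_compProd π κ
    rw [Measure.snd] at this
    rw [this]; exact hinv.def
  have hfst : (π ⊗ₘ κ).map Prod.fst = π := Measure.fst_compProd π κ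
  have key : ∀ a b : Lp ℝ 2 π, inner ℝ (semigroupL2 P π t a) b
      = ∫ z, b z.1 * a z.2 ∂(π ⊗ₘ κ) := by
    intro a b
    have hI : Integrable (fun z : S × S => b z.1 * a z.2) (π ⊗ₘ κ) := by
      have hb : MemLp (fun z : S × S => b z.1) 2 (π ⊗ₘ κ) :=
        MemLp.comp_measurePreserving (Lp.memLp b) ⟨measurable_fst, hfst⟩
      have ha : MemLp (fun z : S × S => a z.2) 2 (π ⊗ₘ κ) :=
        MemLp.comp_measurePreserving (Lp.memLp a) ⟨measurable_snd, hsnd⟩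
      exact hb.integrable_mul ha
    rw [Measure.integral_compProd hI, L2.inner_def]
    refine integral_congr_ae ?_
    filter_upwards [semigroupL2_coe hP hrev t a] with x hx
    rw [integral_const_mul, hx]
    simp [hκ]
  have hmp : MeasurePreserving (MeasurableEquiv.prodComm : S × S ≃ᵐ S × S)
      (π ⊗ₘ κ) (π ⊗ₘ κ) := ⟨measurable_swap, hswap⟩
  rw [key, real_inner_comm, key, ← hmp.integral_comp']
  refine integral_congr_ae (Eventually.of_forall fun z => ?_)
  simp [MeasurableEquiv.prodComm, mul_comm]


theorem diffQuot_sub {P : ℝ≥0 → Kernel S S} {π : Measure S} [IsProbabilityMeasure π]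
    (hP : IsTransitionSemigroup P) (hrev : IsReversibleSemigroup P π) (u v : Lp ℝ 2 π) (t : ℝ≥0) :
    diffQuot P π (u - v) t = diffQuot P π u t - diffQuot P π v t := by
  simp only [diffQuot, semigroupL2_sub hP hrev, ← smul_sub]
  congr 1; abel

theorem tendsto_generator {P : ℝ≥0 → Kernel S S} {π : Measure S} {u : Lp ℝ 2 π}
    (hu : u ∈ generatorDomain P π) :
    Tendsto (diffQuot P π u) (𝓝[>] 0) (𝓝 (generator P π u)) :=
  tendsto_nhds_limUnder hu

theorem generator_sub {P : ℝ≥0 → Kernel S S} {π : Measure S} [IsProbabilityMeasure π]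
    (hP : IsTransitionSemigroup P) (hrev : IsReversibleSemigroup P π) {u v : Lp ℝ 2 π}
    (hu : u ∈ generatorDomain P π) (hv : v ∈ generatorDomain P π) :
    u - v ∈ generatorDomain P π ∧
      generator P π (u - v) = generator P π u - generator P π v := by
  have h : Tendsto (diffQuot P π (u - v)) (𝓝[>] 0)
      (𝓝 (generator P π u - generator P π v)) := by
    have := (tendsto_generator hu).sub (tendsto_generator hv)
    exact this.congr fun t => (diffQuot_sub hP hrev u v t).symm
  exact ⟨⟨_, h⟩, tendsto_nhds_unique (tendsto_generator ⟨_, h⟩) h⟩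

theorem preForm_comm {P : ℝ≥0 → Kernel S S} {π : Measure S} [IsProbabilityMeasure π]
    (hP : IsTransitionSemigroup P) (hrev : IsReversibleSemigroup P π) {u v : Lp ℝ 2 π}
    (hu : u ∈ generatorDomain P π) (hv : v ∈ generatorDomain P π) :
    preForm P π u v = preForm P π v u := by
  have h1 := ((tendsto_generator hu).neg).inner (𝕜 := ℝ) (tendsto_const_nhds (x := v))
  have h2 := ((tendsto_generator hv).neg).inner (𝕜 := ℝ) (tendsto_const_nhds (x := u))
  refine tendsto_nhds_unique h1 (h2.congr fun t => ?_)
  simp only [diffQuot, inner_neg_left, real_inner_smul_left, inner_sub_left,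
    inner_semigroupL2 hP hrev t v u]
  rw [real_inner_comm v u, real_inner_comm v (semigroupL2 P π t u)]

theorem preForm_nonneg {P : ℝ≥0 → Kernel S S} {π : Measure S} [IsProbabilityMeasure π]
    (hP : IsTransitionSemigroup P) (hrev : IsReversibleSemigroup P π) {u : Lp ℝ 2 π}
    (hu : u ∈ generatorDomain P π) : 0 ≤ preForm P π u u := by
  have h1 := ((tendsto_generator hu).neg).inner (𝕜 := ℝ) (tendsto_const_nhds (x := u))
  refine ge_of_tendsto' h1 fun t => ?_
  simp only [diffQuot, inner_neg_left, real_inner_smul_left, inner_sub_left]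
  have h2 := real_inner_le_norm (semigroupL2 P π t u) u
  have h3 := norm_semigroupL2_le hP hrev t u
  have h4 := real_inner_self_eq_norm_mul_norm u
  have h5 : inner ℝ (semigroupL2 P π t u) u - inner ℝ u u ≤ 0 := by
    nlinarith [norm_nonneg u]
  have h6 : (0 : ℝ) ≤ (t : ℝ)⁻¹ := by positivity
  nlinarith [mul_nonneg h6 (neg_nonneg.2 h5)]

theorem preForm_sub_left {P : ℝ≥0 → Kernel S S} {π : Measure S} [IsProbabilityMeasure π]
    (hP : IsTransitionSemigroup P) (hrev : IsReversibleSemigroup P π) {u v z : Lp ℝ 2 π}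
    (hu : u ∈ generatorDomain P π) (hv : v ∈ generatorDomain P π) :
    preForm P π (u - v) z = preForm P π u z - preForm P π v z := by
  simp only [preForm, (generator_sub hP hrev hu hv).2, inner_neg_left, inner_sub_left]
  ring

theorem preForm_sub_right {P : ℝ≥0 → Kernel S S} {π : Measure S} (u v z : Lp ℝ 2 π) :
    preForm P π z (u - v) = preForm P π z u - preForm P π z v := by
  simp only [preForm, inner_sub_right]

/-- Cauchy-Schwarz inequality for the form `(-L u, v)`. -/
theorem preForm_sq_le {P : ℝ≥0 → Kernel S S} {π : Measure S} [IsProbabilityMeasure π]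
    (hP : IsTransitionSemigroup P) (hrev : IsReversibleSemigroup P π) {u v : Lp ℝ 2 π}
    (hu : u ∈ generatorDomain P π) (hv : v ∈ generatorDomain P π) :
    preForm P π u v ^ 2 ≤ preForm P π u u * preForm P π v v := by
  have smul_mem : ∀ (c : ℝ) {w : Lp ℝ 2 π}, w ∈ generatorDomain P π →
      c • w ∈ generatorDomain P π ∧ generator P π (c • w) = c • generator P π w := by
    intro c w hw
    have h : Tendsto (diffQuot P π (c • w)) (𝓝[>] 0) (𝓝 (c • generator P π w)) := by
      refine ((tendsto_generator hw).const_smul c).congr fun t => ?_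
      simp only [diffQuot, semigroupL2_smul hP hrev, ← smul_sub]
      exact smul_comm _ _ _
    exact ⟨⟨_, h⟩, tendsto_nhds_unique (tendsto_generator ⟨_, h⟩) h⟩
  have hq : ∀ c : ℝ, 0 ≤ preForm P π v v * (c * c) + (-2 * preForm P π u v) * c
      + preForm P π u u := by
    intro c
    have h1 := preForm_nonneg hP hrev (generator_sub hP hrev hu (smul_mem c hv).1).1
    rw [preForm_sub_left hP hrev hu (smul_mem c hv).1, preForm_sub_right, preForm_sub_right,
      preForm_comm hP hrev (smul_mem c hv).1 hu] at h1
    have h2 : preForm P π u (c • v) = c * preForm P π u v := by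
      simp [preForm, inner_smul_right]
    have h3 : preForm P π (c • v) (c • v) = c * c * preForm P π v v := by
      simp only [preForm, (smul_mem c hv).2, inner_neg_left, inner_smul_right,
        real_inner_smul_left]
      ring
    rw [h2, h3] at h1
    linarith
  have := discrim_le_zero hq
  rw [discrim] at this
  nlinarith

/-- Closability: the form tends to `0` along an energy-Cauchy sequence which tends to `0`. -/
theorem IsFormApprox.tendsto_zero {P : ℝ≥0 → Kernel S S} {π : Measure S}
    [IsProbabilityMeasure π] (hP : IsTransitionSemigroup P) (hrev : IsReversibleSemigroup P π)
    {w : ℕ → Lp ℝ 2 π} (hw : IsFormApprox P π 0 w) :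
    Tendsto (fun n => preForm P π (w n) (w n)) atTop (𝓝 0) := by
  rw [Metric.tendsto_atTop]
  intro ε hε
  obtain ⟨⟨N, M⟩, hN⟩ := Metric.tendsto_atTop.1 hw.cauchy (ε / 2) (by positivity)
  refine ⟨max N M, fun n hn => ?_⟩
  have hnn := preForm_nonneg hP hrev (hw.mem n)
  have hle : preForm P π (w n) (w n) ^ 2 ≤ preForm P π (w n) (w n) * (ε / 2) := by
    have hlim : Tendsto (fun m => preForm P π (w n) (w n - w m) ^ 2) atTop
        (𝓝 (preForm P π (w n) (w n) ^ 2)) := by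
      have h1 : Tendsto (fun m => w n - w m) atTop (𝓝 (w n)) := by
        simpa using (tendsto_const_nhds (x := w n)).sub hw.tendsto
      exact ((tendsto_const_nhds (x := -generator P π (w n))).inner (𝕜 := ℝ) h1).pow 2
    refine le_of_tendsto hlim ?_
    filter_upwards [eventually_ge_atTop M] with m hm
    have hsub := (generator_sub hP hrev (hw.mem n) (hw.mem m)).1
    refine (preForm_sq_le hP hrev (hw.mem n) hsub).trans ?_
    refine mul_le_mul_of_nonneg_left ?_ hnn
    have := hN (n, m) ⟨(le_max_left _ _).trans hn, hm⟩
    rw [Real.dist_eq, sub_zero] at this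
    exact (le_abs_self _).trans this.le
  rw [Real.dist_eq, sub_zero, abs_of_nonneg hnn]
  by_contra! hcon
  nlinarith

theorem preForm_sub_sq_le {P : ℝ≥0 → Kernel S S} {π : Measure S} [IsProbabilityMeasure π]
    (hP : IsTransitionSemigroup P) (hrev : IsReversibleSemigroup P π) {a a' b b' : Lp ℝ 2 π}
    (ha : a ∈ generatorDomain P π) (ha' : a' ∈ generatorDomain P π)
    (hb : b ∈ generatorDomain P π) (hb' : b' ∈ generatorDomain P π) :
    (preForm P π a b - preForm P π a' b') ^ 2 ≤
      2 * (preForm P π (a - a') (a - a') * preForm P π b b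
        + preForm P π a' a' * preForm P π (b - b') (b - b')) := by
  have h1 := preForm_sq_le hP hrev (generator_sub hP hrev ha ha').1 hb
  have h2 := preForm_sq_le hP hrev ha' (generator_sub hP hrev hb hb').1
  rw [preForm_sub_left hP hrev ha ha' (z := b)] at h1
  rw [preForm_sub_right b b' a'] at h2
  nlinarith [sq_nonneg (preForm P π a b - preForm P π a' b
    - (preForm P π a' b - preForm P π a' b'))]

theorem preForm_sub_self_le {P : ℝ≥0 → Kernel S S} {π : Measure S} [IsProbabilityMeasure π]
    (hP : IsTransitionSemigroup P) (hrev : IsReversibleSemigroup P π) {a b : Lp ℝ 2 π}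
    (ha : a ∈ generatorDomain P π) (hb : b ∈ generatorDomain P π) :
    preForm P π (a - b) (a - b) ≤ 2 * (preForm P π a a + preForm P π b b) := by
  rw [preForm_sub_left hP hrev ha hb, preForm_sub_right, preForm_sub_right,
    preForm_comm hP hrev hb ha]
  nlinarith [preForm_sq_le hP hrev ha hb, preForm_nonneg hP hrev ha, preForm_nonneg hP hrev hb,
    sq_nonneg (preForm P π a a - preForm P π b b)]

theorem IsFormApprox.bounded {P : ℝ≥0 → Kernel S S} {π : Measure S}
    [IsProbabilityMeasure π] (hP : IsTransitionSemigroup P) (hrev : IsReversibleSemigroup P π)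
    {u : Lp ℝ 2 π} {w : ℕ → Lp ℝ 2 π} (hw : IsFormApprox P π u w) :
    ∃ C, 0 ≤ C ∧ ∀ᶠ n in atTop, preForm P π (w n) (w n) ≤ C := by
  obtain ⟨⟨N, M⟩, hN⟩ := Metric.tendsto_atTop.1 hw.cauchy 1 one_pos
  have hM := preForm_nonneg hP hrev (hw.mem M)
  refine ⟨2 * (1 + preForm P π (w M) (w M)) * 2, by positivity, ?_⟩
  filter_upwards [eventually_ge_atTop N] with n hn
  have h1 := hN (n, M) ⟨hn, le_rfl⟩
  rw [Real.dist_eq, sub_zero] at h1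
  have h2 := (le_abs_self _).trans h1.le
  have h3 := (generator_sub hP hrev (hw.mem n) (hw.mem M)).1
  have h4 : preForm P π (w n) (w n) ≤
      2 * (preForm P π (w n - w M) (w n - w M) + preForm P π (w M) (w M)) := by
    have e1 := preForm_sub_left hP hrev (hw.mem n) (hw.mem M) (z := w n - w M)
    rw [preForm_sub_right (w n) (w M) (w n), preForm_sub_right (w n) (w M) (w M),
      preForm_comm hP hrev (hw.mem M) (hw.mem n)] at e1
    have e2 := preForm_sub_right (P := P) (π := π) (w n) (w M) (w M)
    have e3 := preForm_sub_left hP hrev (hw.mem n) (hw.mem M) (z := w M)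
    have e4 := preForm_sq_le hP hrev h3 (hw.mem M)
    have e5 := preForm_nonneg hP hrev h3
    nlinarith [sq_nonneg (preForm P π (w n - w M) (w n - w M) - preForm P π (w M) (w M))]
  linarith

/-- Along two approximating sequences the form converges, and the limit, which is
`dirichletForm`, does not depend on the sequences. -/
theorem IsFormApprox.tendsto_dirichletForm {P : ℝ≥0 → Kernel S S} {π : Measure S}
    [IsProbabilityMeasure π] (hP : IsTransitionSemigroup P) (hrev : IsReversibleSemigroup P π)
    {u v : Lp ℝ 2 π} {w z : ℕ → Lp ℝ 2 π} (hw : IsFormApprox P π u w)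
    (hz : IsFormApprox P π v z) :
    Tendsto (fun n => preForm P π (w n) (z n)) atTop (𝓝 (dirichletForm P π u v)) := by
  have sub_zero_approx : ∀ {x : Lp ℝ 2 π} {a b : ℕ → Lp ℝ 2 π}, IsFormApprox P π x a →
      IsFormApprox P π x b → IsFormApprox P π 0 (fun n => a n - b n) := by
    intro x a b ha hb
    refine ⟨fun n => (generator_sub hP hrev (ha.mem n) (hb.mem n)).1, ?_, ?_⟩
    · simpa using ha.tendsto.sub hb.tendsto
    · have hlim := (ha.cauchy.add hb.cauchy).const_mul 2
      rw [add_zero, mul_zero] at hlim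
      refine squeeze_zero (fun p => preForm_nonneg hP hrev ?_) (fun p => ?_) hlim
      · exact (generator_sub hP hrev (generator_sub hP hrev (ha.mem _) (hb.mem _)).1
          (generator_sub hP hrev (ha.mem _) (hb.mem _)).1).1
      · have h := preForm_sub_self_le hP hrev
          (generator_sub hP hrev (ha.mem p.1) (ha.mem p.2)).1
          (generator_sub hP hrev (hb.mem p.1) (hb.mem p.2)).1
        rwa [sub_sub_sub_comm] at h
  have hdiff : ∀ {ι : Type} {l : Filter ι} {a a' b b' : ι → Lp ℝ 2 π} {C : ℝ},
      (∀ i, a i ∈ generatorDomain P π) → (∀ i, a' i ∈ generatorDomain P π) →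
      (∀ i, b i ∈ generatorDomain P π) → (∀ i, b' i ∈ generatorDomain P π) →
      (∀ᶠ i in l, preForm P π (b i) (b i) ≤ C) → (∀ᶠ i in l, preForm P π (a' i) (a' i) ≤ C) →
      Tendsto (fun i => preForm P π (a i - a' i) (a i - a' i)) l (𝓝 0) →
      Tendsto (fun i => preForm P π (b i - b' i) (b i - b' i)) l (𝓝 0) →
      Tendsto (fun i => preForm P π (a i) (b i) - preForm P π (a' i) (b' i)) l (𝓝 0) := by
    intro ι l a a' b b' C ha ha' hb hb' hC hC' h1 h2
    have hlim := ((h1.mul_const C).add (h2.const_mul C)).const_mul 2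
    rw [zero_mul, mul_zero, add_zero, mul_zero] at hlim
    have hsq : Tendsto (fun i => (preForm P π (a i) (b i) - preForm P π (a' i) (b' i)) ^ 2) l
        (𝓝 0) := by
      refine squeeze_zero' (Eventually.of_forall fun i => sq_nonneg _) ?_ hlim
      filter_upwards [hC, hC'] with i hi hi'
      refine (preForm_sub_sq_le hP hrev (ha i) (ha' i) (hb i) (hb' i)).trans ?_
      have p1 := preForm_nonneg hP hrev (generator_sub hP hrev (ha i) (ha' i)).1
      have p2 := preForm_nonneg hP hrev (generator_sub hP hrev (hb i) (hb' i)).1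
      gcongr
    have := hsq.sqrt
    simp only [Real.sqrt_sq_eq_abs, Real.sqrt_zero] at this
    exact (tendsto_zero_iff_abs_tendsto_zero _).2 this
  have huv : u ∈ formDomain P π ∧ v ∈ formDomain P π := ⟨⟨w, hw⟩, ⟨z, hz⟩⟩
  have hw0 := huv.1.choose_spec
  have hz0 := huv.2.choose_spec
  rw [dirichletForm, dif_pos huv]
  set w0 := huv.1.choose
  set z0 := huv.2.choose
  obtain ⟨C1, hC1, hb1⟩ := hw0.bounded hP hrev
  obtain ⟨C2, hC2, hb2⟩ := hz0.bounded hP hrev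
  obtain ⟨C3, hC3, hb3⟩ := hz.bounded hP hrev
  have hcau : CauchySeq (fun n => preForm P π (w0 n) (z0 n)) := by
    rw [cauchySeq_iff_tendsto_dist_atTop_0]
    have := hdiff (l := (atTop : Filter (ℕ × ℕ))) (C := max C1 C2)
      (a := fun p => w0 p.1) (a' := fun p => w0 p.2) (b := fun p => z0 p.1)
      (b' := fun p => z0 p.2) (fun p => hw0.mem _) (fun p => hw0.mem _) (fun p => hz0.mem _)
      (fun p => hz0.mem _)
      ((tendsto_fst.comp (prod_atTop_atTop_eq (α := ℕ) (β := ℕ)).ge).eventually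
        (hb2.mono fun n hn => hn.trans (le_max_right _ _)))
      ((tendsto_snd.comp (prod_atTop_atTop_eq (α := ℕ) (β := ℕ)).ge).eventually
        (hb1.mono fun n hn => hn.trans (le_max_left _ _)))
      hw0.cauchy hz0.cauchy
    simpa [Real.dist_eq] using this.abs
  have hd := hdiff (l := (atTop : Filter ℕ)) (C := max C1 C3) hw.mem hw0.mem hz.mem hz0.mem
    (hb3.mono fun n hn => hn.trans (le_max_right _ _))
    (hb1.mono fun n hn => hn.trans (le_max_left _ _))
    ((sub_zero_approx hw hw0).tendsto_zero hP hrev) ((sub_zero_approx hz hz0).tendsto_zero hP hrev)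
  simpa using hd.add hcau.tendsto_limUnder

end MarkovAV

end

/-!
The argument avoids the spectral theorem and uses the truncated potentials `V_t = ∫_0^t P_r f dr`,
the autocorrelation `c(r) = (P_r f, f)` and its primitive `K(t) = ∫_0^t c(r) dr = (V_t, f)`. By
reversibility `c(r) = ‖P_{r/2} f‖²`, so `c` is nonnegative and nonincreasing, and `K` increases to a
limit `K(∞) ∈ [0, ∞]`. Both sides of the identity equal `1 / K(∞)`.

The variational side is `iInf_dirichletForm_eq`. One has `-L V_t = f - P_t f`, hence
`E(V_t, V_t) = (f, V_t) - (P_t f, V_t) ≤ K(t)`, and `V_t / K(t)` is an admissible competitor of energy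
at most `1 / K(t)` (`iInf_dirichletForm_le`). Conversely, if `u` is in the form domain and
`(u, f) = 1`, then `(u, f - P_t f) = E(u, V_t)`, and Cauchy–Schwarz bounds its square by
`K(t) E(u, u)` (`sq_inner_sub_orbit_le`). If `K(∞)` is finite then `P_t f → 0`, because
`2 t ‖P_t f‖² ≤ K(2t)`, so that `1 ≤ K(∞) E(u, u)` in the limit (`inv_iSup_le_dirichletForm`).

The probabilistic side is `asymptoticVariance_eq`. The Markov property and stationarity give
`E[f(X_s) f(X_r)] = c(|s - r|)`, so by Fubini the second moment of `∫_0^t f(X_s) ds` is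
`∫_0^t ∫_0^t c(|s - r|) dr ds = 2 ∫_0^t K(s) ds`. Dividing by `t` leaves twice the average of the
increasing function `K` over `[0, t]`, which tends to `2 K(∞)`.
-/

namespace MarkovAV

/-! ### Elements of the generator domain as elements of the form domain -/

theorem isFormApprox_const {S : Type*} [MeasurableSpace S] {P : ℝ≥0 → Kernel S S} {π : Measure S}
    {u : Lp ℝ 2 π} (hu : u ∈ generatorDomain P π) : IsFormApprox P π u fun _ => u := by
  refine ⟨fun _ => hu, tendsto_const_nhds, ?_⟩
  have h : preForm P π (u - u) (u - u) = 0 := by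
    rw [preForm_sub_right, sub_self]
  simp only [h]
  exact tendsto_const_nhds

/-! ### The semigroup on `L²(π)` -/

section Semigroup

variable {S : Type*} [MeasurableSpace S] {P : ℝ≥0 → Kernel S S} {π : Measure S}
  [IsProbabilityMeasure π]

theorem semigroupL2_zero (hP : IsTransitionSemigroup P) (hrev : IsReversibleSemigroup P π)
    (u : Lp ℝ 2 π) : semigroupL2 P π 0 u = u := by
  apply Lp.ext
  filter_upwards [semigroupL2_coe hP hrev 0 u] with x hx
  rw [hx, hP.zero, Kernel.id_apply]
  exact integral_dirac' _ _ (Lp.stronglyMeasurable u)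

theorem semigroupL2_add (hP : IsTransitionSemigroup P) (hrev : IsReversibleSemigroup P π)
    (s t : ℝ≥0) (u : Lp ℝ 2 π) :
    semigroupL2 P π (s + t) u = semigroupL2 P π s (semigroupL2 P π t u) := by
  have := hP.markov
  apply Lp.ext
  filter_upwards [semigroupL2_coe hP hrev (s + t) u,
    semigroupL2_coe hP hrev s (semigroupL2 P π t u),
    ae_ae_of_invariant (hrev s).invariant (semigroupL2_coe hP hrev t u),
    ae_integrable (hrev (s + t)).invariant u] with x h1 h2 h3 h4
  rw [hP.add] at h4
  rw [h1, h2, hP.add, Kernel.integral_comp h4]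
  exact (integral_congr_ae h3).symm

/-- The operator `P_t` on `L²(π)` as a continuous linear map. -/
noncomputable def semigroupCLM (hP : IsTransitionSemigroup P) (hrev : IsReversibleSemigroup P π)
    (t : ℝ≥0) : Lp ℝ 2 π →L[ℝ] Lp ℝ 2 π :=
  LinearMap.mkContinuous
    { toFun := semigroupL2 P π t
      map_add' := fun u v => by
        have h := semigroupL2_sub hP hrev t u ((-1 : ℝ) • v)
        rw [semigroupL2_smul hP hrev] at h
        simpa using h
      map_smul' := fun c u => semigroupL2_smul hP hrev t c u } 1
    (fun u => by simpa using norm_semigroupL2_le hP hrev t u)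

theorem semigroupCLM_apply (hP : IsTransitionSemigroup P) (hrev : IsReversibleSemigroup P π)
    (t : ℝ≥0) (u : Lp ℝ 2 π) : semigroupCLM hP hrev t u = semigroupL2 P π t u := rfl

/-- The orbit `r ↦ P_r f` in `L²(π)`, with real time; it is constantly `f` for `r ≤ 0`. -/
noncomputable def orbit (P : ℝ≥0 → Kernel S S) (π : Measure S) (f : Lp ℝ 2 π) (r : ℝ) :
    Lp ℝ 2 π :=
  semigroupL2 P π r.toNNReal f

theorem norm_semigroupL2_sub_le (hP : IsTransitionSemigroup P)
    (hrev : IsReversibleSemigroup P π) (f : Lp ℝ 2 π) {s t : ℝ≥0} (hst : s ≤ t) :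
    ‖semigroupL2 P π t f - semigroupL2 P π s f‖ ≤ ‖semigroupL2 P π (t - s) f - f‖ := by
  have h : semigroupL2 P π t f = semigroupL2 P π s (semigroupL2 P π (t - s) f) := by
    rw [← semigroupL2_add hP hrev, add_tsub_cancel_of_le hst]
  rw [h, ← semigroupL2_sub hP hrev]
  exact norm_semigroupL2_le hP hrev _ _

theorem continuous_semigroupL2 (hP : IsTransitionSemigroup P) (hrev : IsReversibleSemigroup P π)
    (hcont : IsStronglyContinuous P π) (f : Lp ℝ 2 π) :
    Continuous fun t : ℝ≥0 => semigroupL2 P π t f := by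
  rw [Metric.continuous_iff]
  intro t ε hε
  obtain ⟨δ, hδ, h⟩ := Metric.tendsto_nhdsWithin_nhds.1 (hcont f) ε hε
  refine ⟨δ, hδ, fun s hs => ?_⟩
  have key : ∀ {a b : ℝ≥0}, a ≤ b → dist b a < δ →
      dist (semigroupL2 P π b f) (semigroupL2 P π a f) < ε := by
    intro a b hab hd
    rcases hab.eq_or_lt with rfl | hlt
    · simpa using hε
    · rw [dist_eq_norm]
      refine (norm_semigroupL2_sub_le hP hrev f hab).trans_lt ?_
      rw [← dist_eq_norm]
      refine h (tsub_pos_of_lt hlt) ?_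
      rwa [NNReal.dist_eq, NNReal.coe_zero, sub_zero, NNReal.coe_sub hab, ← NNReal.dist_eq]
  rcases le_total t s with hts | hts
  · exact key hts hs
  · rw [dist_comm]; exact key hts (by rwa [dist_comm])

theorem continuous_orbit (hP : IsTransitionSemigroup P) (hrev : IsReversibleSemigroup P π)
    (hcont : IsStronglyContinuous P π) (f : Lp ℝ 2 π) : Continuous (orbit P π f) :=
  (continuous_semigroupL2 hP hrev hcont f).comp continuous_real_toNNReal

theorem orbit_zero (hP : IsTransitionSemigroup P) (hrev : IsReversibleSemigroup P π)
    (f : Lp ℝ 2 π) : orbit P π f 0 = f := by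
  simp [orbit, semigroupL2_zero hP hrev]

/-! ### Truncated potentials -/

/-- The truncated potential `∫_0^t P_r f dr` of `f`, an element of `L²(π)`. It plays the role of
a solution of the Poisson equation `-L u = f`. -/
noncomputable def truncPotential (P : ℝ≥0 → Kernel S S) (π : Measure S) (f : Lp ℝ 2 π) (t : ℝ) :
    Lp ℝ 2 π :=
  ∫ r in (0 : ℝ)..t, orbit P π f r

theorem semigroupL2_truncPotential (hP : IsTransitionSemigroup P)
    (hrev : IsReversibleSemigroup P π) (hcont : IsStronglyContinuous P π) (f : Lp ℝ 2 π)
    {t : ℝ} (ht : 0 ≤ t) (h : ℝ≥0) :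
    semigroupL2 P π h (truncPotential P π f t) = ∫ r in (h : ℝ)..(t + h), orbit P π f r := by
  have hc := continuous_orbit hP hrev hcont f
  rw [truncPotential, ← semigroupCLM_apply hP hrev,
    ← ContinuousLinearMap.intervalIntegral_comp_comm _ (hc.intervalIntegrable _ _)]
  have e : ∫ r in (0 : ℝ)..t, semigroupCLM hP hrev h (orbit P π f r)
      = ∫ r in (0 : ℝ)..t, orbit P π f (r + h) := by
    refine intervalIntegral.integral_congr fun r hr => ?_
    rw [Set.uIcc_of_le ht] at hr
    simp only [semigroupCLM_apply, orbit]
    rw [← semigroupL2_add hP hrev, add_comm h, Real.toNNReal_add hr.1 h.coe_nonneg, Real.toNNReal_coe]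
  rw [e, intervalIntegral.integral_comp_add_right, zero_add]

/-- The truncated potential solves `L (∫_0^t P_r f dr) = P_t f - f`. -/
theorem tendsto_diffQuot_truncPotential (hP : IsTransitionSemigroup P)
    (hrev : IsReversibleSemigroup P π) (hcont : IsStronglyContinuous P π) (f : Lp ℝ 2 π)
    {t : ℝ} (ht : 0 ≤ t) :
    Tendsto (diffQuot P π (truncPotential P π f t)) (𝓝[>] 0) (𝓝 (orbit P π f t - f)) := by
  have hc := continuous_orbit hP hrev hcont f
  have hd : ∀ b : ℝ, Tendsto (fun h : ℝ≥0 => (h : ℝ)⁻¹ • ∫ r in b..(b + h), orbit P π f r)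
      (𝓝[>] 0) (𝓝 (orbit P π f b)) := by
    intro b
    have h1 := (hc.integral_hasStrictDerivAt b b).hasDerivAt.tendsto_slope_zero_right
    have h2 : Tendsto (fun h : ℝ≥0 => (h : ℝ)) (𝓝[>] 0) (𝓝[>] 0) := by
      refine tendsto_nhdsWithin_iff.2 ⟨?_, ?_⟩
      · exact (NNReal.continuous_coe.tendsto' 0 0 rfl).mono_left nhdsWithin_le_nhds
      · filter_upwards [self_mem_nhdsWithin] with x hx using NNReal.coe_pos.2 hx
    simpa [Function.comp_def] using h1.comp h2
  have h3 := (hd t).sub (hd 0)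
  rw [orbit_zero hP hrev] at h3
  refine h3.congr fun h => ?_
  rw [diffQuot, semigroupL2_truncPotential hP hrev hcont f ht, truncPotential, ← smul_sub]
  congr 1
  have i1 := fun a b => hc.intervalIntegrable (μ := volume) a b
  have e1 := intervalIntegral.integral_add_adjacent_intervals (i1 0 t) (i1 t (t + h))
  have e2 := intervalIntegral.integral_add_adjacent_intervals (i1 0 h) (i1 h (t + h))
  rw [zero_add, ← sub_eq_zero]
  rw [← e2, ← sub_eq_zero] at e1
  rw [← e1]
  abel

theorem truncPotential_mem (hP : IsTransitionSemigroup P)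
    (hrev : IsReversibleSemigroup P π) (hcont : IsStronglyContinuous P π) (f : Lp ℝ 2 π)
    {t : ℝ} (ht : 0 ≤ t) : truncPotential P π f t ∈ generatorDomain P π :=
  ⟨_, tendsto_diffQuot_truncPotential hP hrev hcont f ht⟩

theorem generator_truncPotential (hP : IsTransitionSemigroup P)
    (hrev : IsReversibleSemigroup P π) (hcont : IsStronglyContinuous P π) (f : Lp ℝ 2 π)
    {t : ℝ} (ht : 0 ≤ t) :
    generator P π (truncPotential P π f t) = orbit P π f t - f :=
  tendsto_nhds_unique (tendsto_generator (truncPotential_mem hP hrev hcont f ht))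
    (tendsto_diffQuot_truncPotential hP hrev hcont f ht)

/-! ### The autocorrelation function -/

/-- The stationary autocorrelation `(P_r f, f)`, with real time. -/
noncomputable def autocorr (P : ℝ≥0 → Kernel S S) (π : Measure S) (f : Lp ℝ 2 π) (r : ℝ) : ℝ :=
  inner ℝ (orbit P π f r) f

theorem inner_orbit_orbit (hP : IsTransitionSemigroup P) (hrev : IsReversibleSemigroup P π)
    (f : Lp ℝ 2 π) {s t : ℝ} (hs : 0 ≤ s) (ht : 0 ≤ t) :
    inner ℝ (orbit P π f s) (orbit P π f t) = autocorr P π f (s + t) := by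
  simp only [autocorr, orbit]
  rw [Real.toNNReal_add hs ht, semigroupL2_add hP hrev, inner_semigroupL2 hP hrev _ _ f,
    real_inner_comm]

theorem autocorr_eq_norm_sq (hP : IsTransitionSemigroup P) (hrev : IsReversibleSemigroup P π)
    (f : Lp ℝ 2 π) {r : ℝ} (hr : 0 ≤ r) :
    autocorr P π f r = ‖orbit P π f (r / 2)‖ ^ 2 := by
  rw [← real_inner_self_eq_norm_sq, inner_orbit_orbit hP hrev f (by positivity) (by positivity),
    add_halves]

theorem autocorr_nonneg (hP : IsTransitionSemigroup P) (hrev : IsReversibleSemigroup P π)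
    (f : Lp ℝ 2 π) (r : ℝ) : 0 ≤ autocorr P π f r := by
  rcases le_total 0 r with hr | hr
  · rw [autocorr_eq_norm_sq hP hrev f hr]; positivity
  · rw [autocorr, orbit, Real.toNNReal_of_nonpos hr, semigroupL2_zero hP hrev]
    exact real_inner_self_nonneg

theorem autocorr_anti (hP : IsTransitionSemigroup P) (hrev : IsReversibleSemigroup P π)
    (f : Lp ℝ 2 π) {s t : ℝ} (hs : 0 ≤ s) (hst : s ≤ t) :
    autocorr P π f t ≤ autocorr P π f s := by
  rw [autocorr_eq_norm_sq hP hrev f hs, autocorr_eq_norm_sq hP hrev f (hs.trans hst)]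
  have h : orbit P π f (t / 2)
      = semigroupL2 P π ((t - s) / 2).toNNReal (orbit P π f (s / 2)) := by
    rw [orbit, orbit, ← semigroupL2_add hP hrev, ← Real.toNNReal_add (by linarith) (by linarith)]
    congr 2
    ring
  rw [h]
  gcongr
  exact norm_semigroupL2_le hP hrev _ _

theorem continuous_autocorr (hP : IsTransitionSemigroup P) (hrev : IsReversibleSemigroup P π)
    (hcont : IsStronglyContinuous P π) (f : Lp ℝ 2 π) : Continuous (autocorr P π f) :=
  (continuous_orbit hP hrev hcont f).inner continuous_const

/-- The integrated autocorrelation `∫_0^t (P_r f, f) dr`. -/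
noncomputable def intAutocorr (P : ℝ≥0 → Kernel S S) (π : Measure S) (f : Lp ℝ 2 π) (t : ℝ) : ℝ :=
  ∫ r in (0 : ℝ)..t, autocorr P π f r

theorem inner_truncPotential (hP : IsTransitionSemigroup P)
    (hrev : IsReversibleSemigroup P π) (hcont : IsStronglyContinuous P π) (f g : Lp ℝ 2 π)
    (t : ℝ) :
    inner ℝ (truncPotential P π f t) g = ∫ r in (0 : ℝ)..t, inner ℝ (orbit P π f r) g := by
  have h := ContinuousLinearMap.intervalIntegral_comp_comm (innerSL ℝ g)
    ((continuous_orbit hP hrev hcont f).intervalIntegrable (μ := volume) 0 t)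
  simp only [innerSL_apply_apply] at h
  rw [real_inner_comm, truncPotential, ← h]
  exact intervalIntegral.integral_congr fun r _ => real_inner_comm _ _

theorem inner_truncPotential_self (hP : IsTransitionSemigroup P)
    (hrev : IsReversibleSemigroup P π) (hcont : IsStronglyContinuous P π) (f : Lp ℝ 2 π)
    (t : ℝ) : inner ℝ (truncPotential P π f t) f = intAutocorr P π f t :=
  inner_truncPotential hP hrev hcont f f t

theorem monotone_intAutocorr (hP : IsTransitionSemigroup P)
    (hrev : IsReversibleSemigroup P π) (hcont : IsStronglyContinuous P π) (f : Lp ℝ 2 π) :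
    Monotone (intAutocorr P π f) := by
  intro s t hst
  have i1 := fun a b =>
    (continuous_autocorr hP hrev hcont f).intervalIntegrable (μ := volume) a b
  have e := intervalIntegral.integral_add_adjacent_intervals (i1 0 s) (i1 s t)
  have h := intervalIntegral.integral_nonneg (μ := volume) hst
    fun r _ => autocorr_nonneg hP hrev f r
  simp only [intAutocorr]
  linarith

/-- The energy of the truncated potential is at most its pairing with `f`: the remainder
`(P_t f, ∫_0^t P_r f dr)` is nonnegative. -/
theorem preForm_truncPotential_le (hP : IsTransitionSemigroup P)
    (hrev : IsReversibleSemigroup P π) (hcont : IsStronglyContinuous P π) (f : Lp ℝ 2 π)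
    {t : ℝ} (ht : 0 ≤ t) :
    preForm P π (truncPotential P π f t) (truncPotential P π f t) ≤ intAutocorr P π f t := by
  have h : 0 ≤ inner ℝ (truncPotential P π f t) (orbit P π f t) := by
    rw [inner_truncPotential hP hrev hcont]
    refine intervalIntegral.integral_nonneg ht fun r hr => ?_
    rw [inner_orbit_orbit hP hrev f hr.1 ht]
    exact autocorr_nonneg hP hrev f _
  rw [preForm, generator_truncPotential hP hrev hcont f ht, neg_sub, inner_sub_left,
    real_inner_comm, inner_truncPotential_self hP hrev hcont]
  rw [real_inner_comm] at h
  linarith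

/-! ### The variational problem -/

theorem generator_smul (hP : IsTransitionSemigroup P) (hrev : IsReversibleSemigroup P π) (c : ℝ)
    {u : Lp ℝ 2 π} (hu : u ∈ generatorDomain P π) :
    c • u ∈ generatorDomain P π ∧ generator P π (c • u) = c • generator P π u := by
  have h : Tendsto (diffQuot P π (c • u)) (𝓝[>] 0) (𝓝 (c • generator P π u)) := by
    refine ((tendsto_generator hu).const_smul c).congr fun t => ?_
    simp only [diffQuot, semigroupL2_smul hP hrev, ← smul_sub]
    exact smul_comm _ _ _
  exact ⟨⟨_, h⟩, tendsto_nhds_unique (tendsto_generator ⟨_, h⟩) h⟩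

theorem dirichletForm_eq_preForm (hP : IsTransitionSemigroup P)
    (hrev : IsReversibleSemigroup P π) {u : Lp ℝ 2 π} (hu : u ∈ generatorDomain P π) :
    dirichletForm P π u u = preForm P π u u :=
  tendsto_nhds_unique
    ((isFormApprox_const hu).tendsto_dirichletForm hP hrev (isFormApprox_const hu))
    tendsto_const_nhds

/-- Testing the variational problem with the normalized truncated potential. -/
theorem iInf_dirichletForm_le (hP : IsTransitionSemigroup P) (hrev : IsReversibleSemigroup P π)
    (hcont : IsStronglyContinuous P π) (f : Lp ℝ 2 π) {t : ℝ} (ht : 0 ≤ t) :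
    ⨅ u ∈ constraintSet P π f 1, ENNReal.ofReal (dirichletForm P π u u)
      ≤ (ENNReal.ofReal (intAutocorr P π f t))⁻¹ := by
  rcases le_or_gt (intAutocorr P π f t) 0 with h0 | h0
  -- In this degenerate case (for instance `f = 0`) the right-hand side is `0⁻¹ = ∞`.
  · simp [ENNReal.ofReal_of_nonpos h0]
  have hm := truncPotential_mem hP hrev hcont f ht
  have hle := preForm_truncPotential_le hP hrev hcont f ht
  set V := truncPotential P π f t with hV
  set k := intAutocorr P π f t
  obtain ⟨hm', hg'⟩ := generator_smul hP hrev k⁻¹ hm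
  have hmem : k⁻¹ • V ∈ constraintSet P π f 1 := by
    refine ⟨⟨_, isFormApprox_const hm'⟩, ?_⟩
    rw [real_inner_smul_left, inner_truncPotential_self hP hrev hcont]
    exact inv_mul_cancel₀ h0.ne'
  refine (iInf₂_le _ hmem).trans ?_
  rw [← ENNReal.ofReal_inv_of_pos h0]
  refine ENNReal.ofReal_le_ofReal ?_
  rw [dirichletForm_eq_preForm hP hrev hm']
  have e : preForm P π (k⁻¹ • V) (k⁻¹ • V) = k⁻¹ * (k⁻¹ * preForm P π V V) := by
    simp only [preForm, hg', inner_neg_left, real_inner_smul_left, real_inner_smul_right]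
    ring
  rw [e]
  have : k⁻¹ * preForm P π V V ≤ 1 := by
    rw [inv_mul_le_iff₀ h0]; linarith
  nlinarith [inv_pos.2 h0]

/-- Cauchy–Schwarz for the form, with one argument in the form domain and the other a truncated
potential. -/
theorem sq_inner_sub_orbit_le (hP : IsTransitionSemigroup P) (hrev : IsReversibleSemigroup P π)
    (hcont : IsStronglyContinuous P π) (f : Lp ℝ 2 π) {u : Lp ℝ 2 π} (hu : u ∈ formDomain P π)
    {t : ℝ} (ht : 0 ≤ t) :
    inner ℝ (f - orbit P π f t) u ^ 2 ≤ intAutocorr P π f t * dirichletForm P π u u := by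
  obtain ⟨w, hw⟩ := hu
  have hm := truncPotential_mem hP hrev hcont f ht
  have h1 : Tendsto (fun n => inner ℝ (f - orbit P π f t) (w n) ^ 2) atTop
      (𝓝 (inner ℝ (f - orbit P π f t) u ^ 2)) :=
    ((tendsto_const_nhds (x := f - orbit P π f t)).inner (𝕜 := ℝ) hw.tendsto).pow 2
  refine le_of_tendsto_of_tendsto' h1
    ((hw.tendsto_dirichletForm hP hrev hw).const_mul (intAutocorr P π f t)) fun n => ?_
  have h2 := preForm_sq_le hP hrev hm (hw.mem n)
  rw [preForm, generator_truncPotential hP hrev hcont f ht, neg_sub] at h2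
  refine h2.trans ?_
  gcongr
  · exact preForm_nonneg hP hrev (hw.mem n)
  · exact preForm_truncPotential_le hP hrev hcont f ht

/-- If the integrated autocorrelation stays bounded, then `P_t f → 0`: by monotonicity
`2 t ‖P_t f‖² ≤ ∫_0^{2t} (P_r f, f) dr`. -/
theorem tendsto_orbit_zero (hP : IsTransitionSemigroup P) (hrev : IsReversibleSemigroup P π)
    (hcont : IsStronglyContinuous P π) (f : Lp ℝ 2 π) {M : ℝ}
    (hM : ∀ t, 0 ≤ t → intAutocorr P π f t ≤ M) :
    Tendsto (orbit P π f) atTop (𝓝 0) := by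
  rw [tendsto_zero_iff_norm_tendsto_zero]
  have hlim : Tendsto (fun t : ℝ => √(M / (2 * t))) atTop (𝓝 0) := by
    have : Tendsto (fun t : ℝ => M / (2 * t)) atTop (𝓝 0) :=
      (tendsto_id.const_mul_atTop two_pos).const_div_atTop M
    simpa using this.sqrt
  refine squeeze_zero' (Eventually.of_forall fun t => norm_nonneg _) ?_ hlim
  filter_upwards [eventually_gt_atTop 0] with t ht
  refine Real.le_sqrt_of_sq_le ?_
  have h1 : autocorr P π f (2 * t) = ‖orbit P π f t‖ ^ 2 := by
    rw [autocorr_eq_norm_sq hP hrev f (by positivity)]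
    congr 3
    ring
  rw [← h1, le_div_iff₀ (by positivity)]
  refine le_trans ?_ (hM (2 * t) (by positivity))
  have h2 : ∫ r in (0 : ℝ)..(2 * t), autocorr P π f (2 * t) ≤ intAutocorr P π f (2 * t) := by
    refine intervalIntegral.integral_mono_on (by positivity) (by simp)
      ((continuous_autocorr hP hrev hcont f).intervalIntegrable _ _) fun r hr => ?_
    exact autocorr_anti hP hrev f hr.1 hr.2
  simp only [intervalIntegral.integral_const, sub_zero, smul_eq_mul] at h2
  linarith

/-- The lower bound in the variational formula. -/
theorem inv_iSup_le_dirichletForm (hP : IsTransitionSemigroup P)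
    (hrev : IsReversibleSemigroup P π) (hcont : IsStronglyContinuous P π) (f : Lp ℝ 2 π)
    {u : Lp ℝ 2 π} (hu : u ∈ constraintSet P π f 1) :
    (⨆ t : ℝ≥0, ENNReal.ofReal (intAutocorr P π f t))⁻¹
      ≤ ENNReal.ofReal (dirichletForm P π u u) := by
  set K := ⨆ t : ℝ≥0, ENNReal.ofReal (intAutocorr P π f t) with hK
  rcases eq_or_ne K ∞ with h | h
  · simp [h]
  have hM : ∀ t, 0 ≤ t → intAutocorr P π f t ≤ K.toReal := by
    intro t ht
    rw [← ENNReal.ofReal_le_iff_le_toReal h]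
    exact le_iSup (fun t : ℝ≥0 => ENNReal.ofReal (intAutocorr P π f t)) ⟨t, ht⟩
  have hE : 0 ≤ dirichletForm P π u u := by
    obtain ⟨w, hw⟩ := hu.1
    exact ge_of_tendsto' (hw.tendsto_dirichletForm hP hrev hw)
      fun n => preForm_nonneg hP hrev (hw.mem n)
  have h1 : (1 : ℝ) ≤ K.toReal * dirichletForm P π u u := by
    have hl : Tendsto (fun t => inner ℝ (f - orbit P π f t) u ^ 2) atTop (𝓝 1) := by
      have := (((tendsto_const_nhds (x := f)).sub
        (tendsto_orbit_zero hP hrev hcont f hM)).inner (𝕜 := ℝ)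
        (tendsto_const_nhds (x := u))).pow 2
      rwa [sub_zero, real_inner_comm, hu.2, one_pow] at this
    refine le_of_tendsto hl ?_
    filter_upwards [eventually_ge_atTop 0] with t ht
    exact (sq_inner_sub_orbit_le hP hrev hcont f hu.1 ht).trans
      (mul_le_mul_of_nonneg_right (hM t ht) hE)
  rw [ENNReal.inv_le_iff_le_mul (fun hb => absurd hb ENNReal.ofReal_ne_top) (fun h' => absurd h' h)]
  rw [← ENNReal.ofReal_toReal h, ← ENNReal.ofReal_mul ENNReal.toReal_nonneg]
  simpa using ENNReal.ofReal_le_ofReal h1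

/-- The variational problem is solved by the total integral of the autocorrelation. -/
theorem iInf_dirichletForm_eq (hP : IsTransitionSemigroup P) (hrev : IsReversibleSemigroup P π)
    (hcont : IsStronglyContinuous P π) (f : Lp ℝ 2 π) :
    ⨅ u ∈ constraintSet P π f 1, ENNReal.ofReal (dirichletForm P π u u)
      = (⨆ t : ℝ≥0, ENNReal.ofReal (intAutocorr P π f t))⁻¹ := by
  refine le_antisymm ?_ (le_iInf₂ fun u hu => inv_iSup_le_dirichletForm hP hrev hcont f hu)
  rw [ENNReal.inv_iSup]
  exact le_iInf fun t => iInf_dirichletForm_le hP hrev hcont f t.2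

end Semigroup

/-! ### Two-time laws and the second moment of additive functionals -/

theorem stronglyMeasurable_process {S Ω : Type*} [MeasurableSpace S] [MeasurableSpace Ω]
    {P : ℝ≥0 → Kernel S S} {π : Measure S} {μ : Measure Ω} {X : ℝ≥0 → Ω → S}
    (hX : IsMarkovProcess P π μ X) (f : Lp ℝ 2 π) :
    StronglyMeasurable (fun p : ℝ × Ω => f (X p.1.toNNReal p.2)) :=
  (Lp.stronglyMeasurable f).comp_measurable
    (hX.measurable.comp ((measurable_real_toNNReal.comp measurable_fst).prodMk measurable_snd))

section TwoTimeLaw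

variable {S Ω : Type*} [MeasurableSpace S] [MeasurableSpace Ω] {P : ℝ≥0 → Kernel S S}
  {π : Measure S} {μ : Measure Ω} [IsProbabilityMeasure μ] {X : ℝ≥0 → Ω → S}

/-- The joint law of `X` at two times. Both measures are finite, so it is enough to compare
rectangles, where this is the integrated Markov property. -/
theorem map_prodMk_eq_compProd (hP : IsTransitionSemigroup P) (hX : IsMarkovProcess P π μ X)
    (s t : ℝ≥0) :
    μ.map (fun ω => (X s ω, X (s + t) ω)) = μ.map (X s) ⊗ₘ P t := by
  have := hP.markov t
  have hm : ∀ r, Measurable (X r) := fun r => hX.measurable.comp measurable_prodMk_left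
  have hpast : past X s ≤ (inferInstance : MeasurableSpace Ω) :=
    iSup_le fun r => (hm r).comap_le
  have : IsProbabilityMeasure (μ.map (X s)) := Measure.isProbabilityMeasure_map (hm s).aemeasurable
  have hpair : Measurable (fun ω => (X s ω, X (s + t) ω)) := (hm s).prodMk (hm (s + t))
  refine Measure.ext_prod fun {B A} hB hA => ?_
  rw [Measure.map_apply hpair (hB.prod hA), Measure.compProd_apply_prod hB hA,
    ← ENNReal.toReal_eq_toReal_iff' (measure_ne_top _ _)
      (ne_top_of_le_ne_top ENNReal.one_ne_top _)]
  · have hBp : MeasurableSet[past X s] (X s ⁻¹' B) :=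
      le_iSup (fun r : Set.Iic s => MeasurableSpace.comap (X r) inferInstance) ⟨s, Set.self_mem_Iic⟩ _
        ⟨B, hB, rfl⟩
    have hint : Integrable (fun ω => A.indicator (fun _ => (1 : ℝ)) (X (s + t) ω)) μ :=
      (integrable_const (1 : ℝ)).indicator (hm (s + t) hA)
    have h1 := setIntegral_condExp hpast hint hBp
    rw [setIntegral_congr_ae (g := fun ω => (P t (X s ω)).real A) (hm s hB)
      ((hX.markov s t A hA).mono fun ω h _ => h)] at h1
    have h2 : ∫ ω in X s ⁻¹' B, A.indicator (fun _ => (1 : ℝ)) (X (s + t) ω) ∂μ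
        = μ.real (X s ⁻¹' B ∩ X (s + t) ⁻¹' A) := by
      have e : (fun ω => A.indicator (fun _ => (1 : ℝ)) (X (s + t) ω))
          = (X (s + t) ⁻¹' A).indicator 1 := rfl
      rw [e, integral_indicator_one (hm (s + t) hA), measureReal_restrict_apply (hm (s + t) hA),
        Set.inter_comm]
    rw [h2] at h1
    have hmeas : Measurable fun x => P t x A := (P t).measurable_coe hA
    have h3 : ∫ ω in X s ⁻¹' B, (P t (X s ω)).real A ∂μ
        = (∫⁻ x in B, P t x A ∂(μ.map (X s))).toReal := by
      rw [← setIntegral_map (f := fun x => (P t x).real A) hB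
        hmeas.ennreal_toReal.aestronglyMeasurable (hm s).aemeasurable]
      exact integral_toReal hmeas.aemeasurable (Eventually.of_forall fun x => measure_lt_top _ _)
    rw [← h3, h1]
    rfl
  · calc ∫⁻ x in B, P t x A ∂(μ.map (X s)) ≤ ∫⁻ x in B, 1 ∂(μ.map (X s)) :=
          lintegral_mono fun x => prob_le_one
      _ ≤ 1 := by simpa using prob_le_one

variable [IsProbabilityMeasure π]

theorem map_eq_stationary (hP : IsTransitionSemigroup P) (hrev : IsReversibleSemigroup P π)
    (hX : IsMarkovProcess P π μ X) (t : ℝ≥0) : μ.map (X t) = π := by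
  have := hP.markov t
  have hm : ∀ r, Measurable (X r) := fun r => hX.measurable.comp measurable_prodMk_left
  have h := congrArg Measure.snd (map_prodMk_eq_compProd hP hX 0 t)
  rw [Measure.snd_map_prodMk (hm 0), hX.initial, Measure.snd_compProd, zero_add] at h
  rw [h]
  exact (hrev t).invariant.def

theorem memLp_comp_process (hP : IsTransitionSemigroup P) (hrev : IsReversibleSemigroup P π)
    (hX : IsMarkovProcess P π μ X) (f : Lp ℝ 2 π) (t : ℝ≥0) :
    MemLp (fun ω => f (X t ω)) 2 μ :=
  (Lp.memLp f).comp_measurePreserving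
    ⟨hX.measurable.comp measurable_prodMk_left, map_eq_stationary hP hrev hX t⟩

theorem integral_mul_process_add (hP : IsTransitionSemigroup P)
    (hrev : IsReversibleSemigroup P π) (hX : IsMarkovProcess P π μ X) (f : Lp ℝ 2 π)
    (s t : ℝ≥0) :
    ∫ ω, f (X s ω) * f (X (s + t) ω) ∂μ = inner ℝ (semigroupL2 P π t f) f := by
  have := hP.markov t
  have hm : ∀ r, Measurable (X r) := fun r => hX.measurable.comp measurable_prodMk_left
  have hpair : Measurable (fun ω => (X s ω, X (s + t) ω)) := (hm s).prodMk (hm (s + t))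
  have hf : StronglyMeasurable (f : S → ℝ) := Lp.stronglyMeasurable f
  have hmap := map_prodMk_eq_compProd hP hX s t
  rw [map_eq_stationary hP hrev hX] at hmap
  have hsm : AEStronglyMeasurable (fun z : S × S => f z.1 * f z.2)
      (μ.map fun ω => (X s ω, X (s + t) ω)) :=
    ((hf.comp_measurable measurable_fst).mul
      (hf.comp_measurable measurable_snd)).aestronglyMeasurable
  have hI : Integrable (fun z : S × S => f z.1 * f z.2) (π ⊗ₘ P t) := by
    rw [← hmap, integrable_map_measure hsm hpair.aemeasurable]
    exact (memLp_comp_process hP hrev hX f s).integrable_mul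
      (memLp_comp_process hP hrev hX f (s + t))
  have h := integral_map hpair.aemeasurable hsm
  rw [← h, hmap, Measure.integral_compProd hI, L2.inner_def]
  refine integral_congr_ae ?_
  filter_upwards [semigroupL2_coe hP hrev t f] with x hx
  rw [integral_const_mul, hx]
  simp

/-- The covariance of the stationary process at two times. -/
theorem integral_mul_process (hP : IsTransitionSemigroup P)
    (hrev : IsReversibleSemigroup P π) (hX : IsMarkovProcess P π μ X) (f : Lp ℝ 2 π)
    {s r : ℝ} (hs : 0 ≤ s) (hr : 0 ≤ r) :
    ∫ ω, f (X s.toNNReal ω) * f (X r.toNNReal ω) ∂μ = autocorr P π f |s - r| := by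
  wlog h : s ≤ r generalizing s r
  · rw [abs_sub_comm, ← this hr hs (le_of_not_ge h)]
    simp only [mul_comm]
  have e : r.toNNReal = s.toNNReal + (r - s).toNNReal := by
    rw [← Real.toNNReal_add hs (sub_nonneg.2 h)]; congr 1; ring
  rw [e, integral_mul_process_add hP hrev hX, abs_sub_comm, abs_of_nonneg (sub_nonneg.2 h)]
  rfl

/-- Joint integrability of `f(X_s) f(X_r)` in `(ω, s, r)`, as needed for Fubini: each factor is square
integrable because, by stationarity, its second moment over `Ω` is `‖f‖²` at every time. -/
theorem integrable_mul_process (hP : IsTransitionSemigroup P)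
    (hrev : IsReversibleSemigroup P π) (hX : IsMarkovProcess P π μ X) (f : Lp ℝ 2 π)
    (ν : Measure ℝ) [IsFiniteMeasure ν] :
    Integrable (fun z : Ω × (ℝ × ℝ) => f (X z.2.1.toNNReal z.1) * f (X z.2.2.toNNReal z.1))
      (μ.prod (ν.prod ν)) := by
  have hL2 : ∀ q : ℝ × ℝ → ℝ, Measurable q →
      MemLp (fun z : Ω × (ℝ × ℝ) => f (X (q z.2).toNNReal z.1)) 2 (μ.prod (ν.prod ν)) := by
    intro q hq
    have hsm : StronglyMeasurable fun z : Ω × (ℝ × ℝ) => f (X (q z.2).toNNReal z.1) :=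
      (stronglyMeasurable_process hX f).comp_measurable
        ((hq.comp measurable_snd).prodMk measurable_fst)
    rw [memLp_two_iff_integrable_sq hsm.aestronglyMeasurable]
    refine (integrable_prod_iff' (hsm.pow 2).aestronglyMeasurable).2 ⟨Eventually.of_forall fun p =>
      (memLp_comp_process hP hrev hX f (q p).toNNReal).integrable_sq, ?_⟩
    have e : ∀ p : ℝ × ℝ, ∫ ω, ‖f (X (q p).toNNReal ω) ^ 2‖ ∂μ
        = inner ℝ (semigroupL2 P π 0 f) f := by
      intro p
      rw [← integral_mul_process_add hP hrev hX f (q p).toNNReal 0]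
      refine integral_congr_ae (Eventually.of_forall fun ω => ?_)
      simp [sq]
    exact (integrable_const _).congr (Eventually.of_forall fun p => (e p).symm)
  exact (hL2 _ measurable_fst).integrable_mul (hL2 _ measurable_snd)

/-- The second moment of `∫_0^t f(X_s) ds`, by Fubini. -/
theorem lintegral_sq_eq (hP : IsTransitionSemigroup P)
    (hrev : IsReversibleSemigroup P π) (hX : IsMarkovProcess P π μ X) (f : Lp ℝ 2 π)
    {t : ℝ} (ht : 0 ≤ t) (a : ℝ) :
    ∫⁻ ω, ENNReal.ofReal ((a * ∫ s in (0 : ℝ)..t, f (X s.toNNReal ω)) ^ 2) ∂μ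
      = ENNReal.ofReal (a ^ 2 * ∫ p in Set.Ioc 0 t ×ˢ Set.Ioc 0 t, autocorr P π f |p.1 - p.2|) := by
  set ν : Measure ℝ := volume.restrict (Set.Ioc 0 t) with hν
  have hI := integrable_mul_process hP hrev hX f ν
  have e : ∀ ω, (a * ∫ s in (0 : ℝ)..t, f (X s.toNNReal ω)) ^ 2
      = a ^ 2 * ∫ p, f (X p.1.toNNReal ω) * f (X p.2.toNNReal ω) ∂(ν.prod ν) := by
    intro ω
    rw [integral_prod_mul (fun s : ℝ => f (X s.toNNReal ω)) (fun s : ℝ => f (X s.toNNReal ω)),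
      intervalIntegral.integral_of_le ht]
    ring
  have hI2 : Integrable (fun ω => (a * ∫ s in (0 : ℝ)..t, f (X s.toNNReal ω)) ^ 2) μ := by
    simp only [e]
    exact hI.integral_prod_left.const_mul _
  rw [← ofReal_integral_eq_lintegral_ofReal hI2 (Eventually.of_forall fun ω => sq_nonneg _)]
  simp only [e]
  rw [integral_const_mul, integral_integral_swap hI, hν, Measure.prod_restrict]
  congr 2
  refine setIntegral_congr_fun (measurableSet_Ioc.prod measurableSet_Ioc) fun p hp => ?_
  exact integral_mul_process hP hrev hX f hp.1.1.le hp.2.1.le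

end TwoTimeLaw

/-! ### The double integral of the autocorrelation -/

section Limit

variable {S : Type*} [MeasurableSpace S] {P : ℝ≥0 → Kernel S S} {π : Measure S}
  [IsProbabilityMeasure π]

theorem integral_autocorr_abs_sub (hP : IsTransitionSemigroup P)
    (hrev : IsReversibleSemigroup P π) (hcont : IsStronglyContinuous P π) (f : Lp ℝ 2 π)
    {s t : ℝ} (hs : 0 ≤ s) (hst : s ≤ t) :
    ∫ r in (0 : ℝ)..t, autocorr P π f |s - r|
      = intAutocorr P π f s + intAutocorr P π f (t - s) := by
  have hc := continuous_autocorr hP hrev hcont f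
  have hc' : Continuous fun r => autocorr P π f |s - r| := by fun_prop
  rw [← intervalIntegral.integral_add_adjacent_intervals (hc'.intervalIntegrable 0 s)
    (hc'.intervalIntegrable s t)]
  congr 1
  · have h : ∫ r in (0 : ℝ)..s, autocorr P π f |s - r|
        = ∫ r in (0 : ℝ)..s, autocorr P π f (s - r) := by
      refine intervalIntegral.integral_congr fun r hr => ?_
      rw [Set.uIcc_of_le hs] at hr
      simp only [abs_of_nonneg (sub_nonneg.2 hr.2)]
    rw [h, intervalIntegral.integral_comp_sub_left, sub_self, sub_zero, intAutocorr]
  · have h : ∫ r in s..t, autocorr P π f |s - r| = ∫ r in s..t, autocorr P π f (r - s) := by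
      refine intervalIntegral.integral_congr fun r hr => ?_
      rw [Set.uIcc_of_le hst] at hr
      simp only [abs_sub_comm s r, abs_of_nonneg (sub_nonneg.2 hr.1)]
    rw [h, intervalIntegral.integral_comp_sub_right, sub_self, intAutocorr]

theorem continuous_intAutocorr (hP : IsTransitionSemigroup P)
    (hrev : IsReversibleSemigroup P π) (hcont : IsStronglyContinuous P π) (f : Lp ℝ 2 π) :
    Continuous (intAutocorr P π f) :=
  intervalIntegral.continuous_primitive
    (fun a b => (continuous_autocorr hP hrev hcont f).intervalIntegrable a b) 0

/-- The variance of the additive functional is governed by the average of the increasing function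
`intAutocorr`, since `∫_0^t ∫_0^t c(|s - r|) dr ds` has inner integral `K(s) + K(t - s)`. -/
theorem integral_prod_autocorr (hP : IsTransitionSemigroup P)
    (hrev : IsReversibleSemigroup P π) (hcont : IsStronglyContinuous P π) (f : Lp ℝ 2 π)
    {t : ℝ} (ht : 0 ≤ t) :
    ∫ p in Set.Ioc 0 t ×ˢ Set.Ioc 0 t, autocorr P π f |p.1 - p.2|
      = 2 * ∫ s in (0 : ℝ)..t, intAutocorr P π f s := by
  have hc := continuous_autocorr hP hrev hcont f
  have hk := continuous_intAutocorr hP hrev hcont f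
  have hc' : Continuous fun p : ℝ × ℝ => autocorr P π f |p.1 - p.2| := by fun_prop
  have hI : IntegrableOn (fun p : ℝ × ℝ => autocorr P π f |p.1 - p.2|)
      (Set.Ioc 0 t ×ˢ Set.Ioc 0 t) :=
    (hc'.continuousOn.integrableOn_compact (isCompact_Icc.prod isCompact_Icc)).mono_set
      (Set.prod_mono Set.Ioc_subset_Icc_self Set.Ioc_subset_Icc_self)
  rw [Measure.volume_eq_prod] at hI ⊢
  rw [setIntegral_prod _ hI, ← intervalIntegral.integral_of_le ht]
  have h : ∫ s in (0 : ℝ)..t, ∫ r in Set.Ioc 0 t, autocorr P π f |s - r|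
      = ∫ s in (0 : ℝ)..t, (intAutocorr P π f s + intAutocorr P π f (t - s)) := by
    refine intervalIntegral.integral_congr fun s hs => ?_
    rw [Set.uIcc_of_le ht] at hs
    simp only [← intervalIntegral.integral_of_le ht]
    exact integral_autocorr_abs_sub hP hrev hcont f hs.1 hs.2
  have hk' : Continuous fun s => intAutocorr P π f (t - s) := by fun_prop
  rw [h, intervalIntegral.integral_add (hk.intervalIntegrable _ _) (hk'.intervalIntegrable _ _),
    intervalIntegral.integral_comp_sub_left, sub_self, sub_zero]
  ring

end Limit

/-! ### Averages of monotone functions -/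

/-- The averages `t⁻¹ ∫_0^t K` of a nonnegative monotone function tend to its supremum; the bound
from below keeps only the mass of `[a, t]`, on which `K ≥ K a`. -/
theorem limsup_ofReal_average {K : ℝ → ℝ} (hmono : Monotone K) (h0 : K 0 = 0)
    (c : ℝ) (hc : 0 ≤ c) :
    limsup (fun t : ℝ => ENNReal.ofReal (c * (t⁻¹ * ∫ s in (0 : ℝ)..t, K s))) atTop
      = ENNReal.ofReal c * ⨆ t : ℝ≥0, ENNReal.ofReal (K t) := by
  have hi : ∀ a b, IntervalIntegrable K volume a b := fun a b => hmono.intervalIntegrable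
  have hnn : ∀ {t}, 0 ≤ t → 0 ≤ K t := fun ht => h0 ▸ hmono ht
  refine le_antisymm ?_ ?_
  · refine limsup_le_of_le (h := ?_)
    filter_upwards [eventually_gt_atTop 0] with t ht
    rw [ENNReal.ofReal_mul hc]
    gcongr
    refine le_trans (ENNReal.ofReal_le_ofReal ?_)
      (le_iSup (fun t : ℝ≥0 => ENNReal.ofReal (K t)) ⟨t, ht.le⟩)
    rw [inv_mul_le_iff₀ ht]
    have := intervalIntegral.integral_mono_on ht.le (hi 0 t) (by simp)
      fun s hs => hmono hs.2
    rw [intervalIntegral.integral_const, sub_zero, smul_eq_mul] at this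
    exact this
  · rw [ENNReal.mul_iSup]
    refine iSup_le fun a => ?_
    have hlim : Tendsto (fun t : ℝ => ENNReal.ofReal (c * ((1 - a / t) * K a))) atTop
        (𝓝 (ENNReal.ofReal (c * ((1 - 0) * K a)))) :=
      ENNReal.tendsto_ofReal ((((tendsto_id.const_div_atTop (a : ℝ)).const_sub 1).mul_const
        _).const_mul c)
    rw [← ENNReal.ofReal_mul hc]
    rw [sub_zero, one_mul] at hlim
    rw [← hlim.limsup_eq]
    refine limsup_le_limsup ?_
    filter_upwards [eventually_gt_atTop (a : ℝ)] with t hat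
    have ht : 0 < t := a.2.trans_lt hat
    refine ENNReal.ofReal_le_ofReal (mul_le_mul_of_nonneg_left ?_ hc)
    rw [le_inv_mul_iff₀ ht, ← intervalIntegral.integral_add_adjacent_intervals (hi 0 a) (hi a t)]
    have h1 : 0 ≤ ∫ s in (0 : ℝ)..a, K s :=
      intervalIntegral.integral_nonneg a.2 fun s hs => hnn hs.1
    have h2 : ∫ s in (a : ℝ)..t, K a ≤ ∫ s in (a : ℝ)..t, K s :=
      intervalIntegral.integral_mono_on hat.le (by simp) (hi a t) fun s hs => hmono hs.1
    rw [intervalIntegral.integral_const, smul_eq_mul] at h2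
    have e : t * ((1 - a / t) * K a) = (t - a) * K a := by field_simp
    linarith

/-! ### The asymptotic variance and the variational formula -/

/-- The asymptotic variance is twice the total integral of the autocorrelation. -/
theorem asymptoticVariance_eq {S Ω : Type*} [MeasurableSpace S] [MeasurableSpace Ω]
    {P : ℝ≥0 → Kernel S S} {π : Measure S} [IsProbabilityMeasure π] {μ : Measure Ω}
    [IsProbabilityMeasure μ] {X : ℝ≥0 → Ω → S} (hP : IsTransitionSemigroup P)
    (hrev : IsReversibleSemigroup P π) (hcont : IsStronglyContinuous P π)
    (hX : IsMarkovProcess P π μ X) (f : Lp ℝ 2 π) :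
    asymptoticVariance μ X f = 2 * ⨆ t : ℝ≥0, ENNReal.ofReal (intAutocorr P π f t) := by
  have h := limsup_ofReal_average (monotone_intAutocorr hP hrev hcont f)
    (by simp [intAutocorr]) 2 zero_le_two
  rw [ENNReal.ofReal_ofNat] at h
  rw [← h, asymptoticVariance]
  refine limsup_congr ?_
  filter_upwards [eventually_gt_atTop 0] with t ht
  rw [lintegral_sq_eq hP hrev hX f ht.le, integral_prod_autocorr hP hrev hcont f ht.le, div_pow,
    one_pow, Real.sq_sqrt ht.le]
  congr 1
  ring

end MarkovAV

theorem theorem1p4 {S Ω : Type*} [TopologicalSpace S] [PolishSpace S] [MeasurableSpace S]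
    [BorelSpace S] [MeasurableSpace Ω]
    (P : ℝ≥0 → Kernel S S) (π : Measure S) [IsProbabilityMeasure π]
    (μ : Measure Ω) [IsProbabilityMeasure μ] (X : ℝ≥0 → Ω → S)
    (hP : MarkovAV.IsTransitionSemigroup P)
    (hrev : MarkovAV.IsReversibleSemigroup P π)
    (hcont : MarkovAV.IsStronglyContinuous P π)
    (herg : MarkovAV.IsErgodicSemigroup P π)
    (hX : MarkovAV.IsMarkovProcess P π μ X)
    (f : Lp ℝ 2 π) (hf : ∫ x, f x ∂π = 0) :
    2 / MarkovAV.asymptoticVariance μ X f =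
      ⨅ u ∈ MarkovAV.constraintSet P π f 1,
        ENNReal.ofReal (MarkovAV.dirichletForm P π u u) := by
  rw [MarkovAV.asymptoticVariance_eq hP hrev hcont hX f,
    MarkovAV.iInf_dirichletForm_eq hP hrev hcont f, ENNReal.div_eq_inv_mul,
    ENNReal.mul_inv (Or.inl two_ne_zero) (Or.inl ENNReal.ofNat_ne_top), mul_right_comm,
    ENNReal.inv_mul_cancel two_ne_zero ENNReal.ofNat_ne_top, one_mul]
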